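/- For $\lambda\in\mathbb{C}\setminus\{0,1\}$ let $E_\lambda\colon y^2=x(x-1)(x-\lambda)$, and for $\alpha\in\mathbb{C}\setminus\{0,1\}$ let $T(\alpha)$ be the set of all $\lambda\in\mathbb{C}\setminus\{0,1\}$ such that the points of $E_\lambda$ with $x$-coordinate $\alpha$ are torsion points. Let $\bar{\mathbb{Q}}\subset\mathbb{C}$ be the field of algebraic numbers and fix an embedding $i\colon\bar{\mathbb{Q}}\hookrightarrow\bar{\mathbb{Q}}_2$. Let $Z\subseteq\bar{\mathbb{Q}}$ be the subring of all $x$ such that $i(x)$ is integral (lies in the valuation ring of $\bar{\mathbb{Q}}_2$), and let $\rho\colon\bar{\mathbb{Q}}\to\mathbb{P}^1(\bar{\mathbb{F}}_2)=\bar{\mathbb{F}}_2\cup\{\infty\}$ be the reduction map, which sends $x\in Z$ to the residue class of $i(x)$ and $x\notin Z$ to $\infty$. (1) Let $\alpha\in Z\setminus\{0,1\}$. Then $$T(\alpha)\subseteq\Bigl\{\alpha,\alpha^2,\alpha(2-\alpha),\frac{\alpha^2}{2\alpha-1}\Bigr\}\cup\{\alpha^2+2u\alpha(1-\alpha):u\in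 Z,\ \rho(u^2)=\rho(\alpha)\}\subseteq\{\alpha\}\cup(\alpha^2+2Z).$$ (2) Let $\alpha\in\bar{\mathbb{Q}}$ with $\rho(\alpha)=\infty$. Then $$T(\alpha)\subseteq\Bigl\{\alpha,\alpha^2,\alpha(2-\alpha),\frac{\alpha^2}{2\alpha-1}\Bigr\}\cup\Bigl\{\frac{\alpha^2}{1+2(\alpha-1)u}:u\in Z,\ \rho(u)=0\Bigr\}.$$ In (2), expressions whose denominator vanishes are omitted. -/

import Mathlib

open scoped OnePoint

noncomputable section

namespace LegendreTorsion

/-- The field `ℚ̄` of algebraic numbers, as a subfield of `ℂ`. -/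
abbrev QBar : IntermediateField ℚ ℂ := algebraicClosure ℚ ℂ

/-- The Legendre curve `E_lam : y² = x (x - 1) (x - lam) = x³ - (1 + lam) x² + lam x`. -/
def legendre (lam : ℂ) : WeierstrassCurve.Affine ℂ where
  a₁ := 0
  a₂ := -(1 + lam)
  a₃ := 0
  a₄ := lam
  a₆ := 0

/-- Check of the coefficients: the affine equation is the Legendre equation. -/
theorem legendre_equation (lam x y : ℂ) :
    (legendre lam).Equation x y ↔ y ^ 2 = x * (x - 1) * (x - lam) := by
  rw [WeierstrassCurve.Affine.equation_iff]
  simp only [legendre]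
  constructor <;> intro h <;> linear_combination h

open Classical in
/-- The set `T(α)` of all `lam ∈ ℂ ∖ {0, 1}` such that a point of `E_lam` with `x`-coordinate `α`
is torsion.  (The at most two points with `x`-coordinate `α` are negatives of each other.) -/
def T (α : ℂ) : Set ℂ :=
  {lam | lam ≠ 0 ∧ lam ≠ 1 ∧ ∃ (y : ℂ) (h : (legendre lam).Nonsingular α y),
    IsOfFinAddOrder (WeierstrassCurve.Affine.Point.some α y h : (legendre lam).Point)}

/-- The valuation ring of `ℚ̄₂`. -/
abbrev O2 : ValuationSubring (PadicAlgCl 2) :=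
  (PadicAlgCl.valued 2).v.valuationSubring

/-- The residue field `𝔽̄₂` of `ℚ̄₂`. -/
abbrev F2Bar : Type := IsLocalRing.ResidueField O2

/-- The ring `Z` of elements of `ℚ̄` that are 2-adically integral with respect to the embedding
`i : ℚ̄ → ℚ̄₂`. -/
def Z (i : QBar →+* PadicAlgCl 2) : Subring QBar := O2.toSubring.comap i

open Classical in
/-- The reduction map `ρ : ℚ̄ → ℙ¹(ℚ̄₂) → ℙ¹(𝔽̄₂) = 𝔽̄₂ ∪ {∞}`. -/
def rho (i : QBar →+* PadicAlgCl 2) (x : QBar) : OnePoint F2Bar :=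
  if h : i x ∈ O2 then ((IsLocalRing.residue O2 ⟨i x, h⟩ : F2Bar) : OnePoint F2Bar) else ∞

/-- The set `{α, α², α (2 - α), α² / (2 α - 1)}`, the last element being present
only if its denominator does not vanish. -/
def S (α : QBar) : Set QBar :=
  {α, α ^ 2, α * (2 - α)} ∪ {x | 2 * α - 1 ≠ 0 ∧ x = α ^ 2 / (2 * α - 1)}

/-- `{α² + 2 u α (1 - α) : u ∈ Z, ρ(u²) = ρ(α)}`. -/
def RInt (i : QBar →+* PadicAlgCl 2) (α : QBar) : Set QBar :=
  {x | ∃ u ∈ Z i, rho i (u ^ 2) = rho i α ∧ x = α ^ 2 + 2 * u * α * (1 - α)}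

/-- `{α² / (1 + 2 (α - 1) u) : u ∈ Z, ρ(u) = 0}`, where only those `u` are used for which the
denominator does not vanish. -/
def RInf (i : QBar →+* PadicAlgCl 2) (α : QBar) : Set QBar :=
  {x | ∃ u ∈ Z i, rho i u = ((0 : F2Bar) : OnePoint F2Bar) ∧
    1 + 2 * (α - 1) * u ≠ 0 ∧ x = α ^ 2 / (1 + 2 * (α - 1) * u)}

end LegendreTorsion

end

noncomputable section

namespace LegendreTorsion

/-! A torsion point has a finite orbit under doubling, so only the doubling map on `x`-coordinates
matters. Its iterates at `α`, as functions of `lam`, have distinct residues at `lam = α`, so a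
finite orbit forces `lam` to be algebraic (`isAlgebraic_of_finiteOrbit`).

At a place above 2, let `x` be integral and not 2-torsion. The 4 in the denominator makes
nonintegral values escape, so `lam` is integral and `x² ≡ lam`. If `w = double lam x` is not
2-torsion either, then `w² ≡ lam`, hence `w ≡ x`. Writing `lam = x² + 2ux(1 - x)` gives `w(2u - 1) =
u²`, so `u` is integral and `u² ≡ x` (`FiniteOrbit.param_cases`). The exceptions, `x` or `w` in `{0,
1, lam}`, make up `S`. Nonintegral `α` reduces to this by inverting both `lam` and `α`. -/

/-! ### The doubling map on `x`-coordinates -/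

section Doubling

variable {F : Type*} [Field F]

/-- The doubling map on `x`-coordinates of `y² = x (x - 1) (x - lam)`.  Division by zero sends the
`2`-torsion values `0`, `1`, `lam` to `0`, which also stands for the point at infinity. -/
def double (lam x : F) : F := (x ^ 2 - lam) ^ 2 / (4 * x * (x - 1) * (x - lam))

/-- The forward orbit of `x` under the doubling map is finite. -/
def FiniteOrbit (lam x : F) : Prop := ∃ m n, m < n ∧ (double lam)^[m] x = (double lam)^[n] x

theorem map_double {K : Type*} [Field K] (f : F →+* K) (lam x : F) :
    f (double lam x) = double (f lam) (f x) := by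
  simp [double, map_ofNat f 4]

theorem finiteOrbit_map_iff {K : Type*} [Field K] (f : F →+* K) (lam x : F) :
    FiniteOrbit (f lam) (f x) ↔ FiniteOrbit lam x := by
  have h : Function.Semiconj f (double lam) (double (f lam)) := fun x => map_double f lam x
  simp only [FiniteOrbit, ← (h.iterate_right _).eq, f.injective.eq_iff]

theorem FiniteOrbit.succ {lam x : F} (h : FiniteOrbit lam x) :
    ∃ m n, m < n ∧ (double lam)^[m + 1] x = (double lam)^[n + 1] x := by
  obtain ⟨m, n, hmn, h⟩ := h
  exact ⟨m, n, hmn, by simp only [Function.iterate_succ_apply', h]⟩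

theorem FiniteOrbit.double {lam x : F} (h : FiniteOrbit lam x) :
    FiniteOrbit lam (LegendreTorsion.double lam x) := by
  obtain ⟨m, n, hmn, h⟩ := h.succ
  exact ⟨m, n, hmn, h⟩

theorem double_inv_mul {lam : F} (h : lam ≠ 0) (x : F) :
    double lam⁻¹ (lam⁻¹ * x) = lam⁻¹ * double lam x := by
  have h1 : ((lam⁻¹ * x) ^ 2 - lam⁻¹) ^ 2 = (lam⁻¹) ^ 4 * (x ^ 2 - lam) ^ 2 := by
    field_simp
  have h2 : 4 * (lam⁻¹ * x) * (lam⁻¹ * x - 1) * (lam⁻¹ * x - lam⁻¹) =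
      (lam⁻¹) ^ 3 * (4 * x * (x - 1) * (x - lam)) := by
    field_simp
  rw [double, double, h1, h2, pow_succ (lam⁻¹) 3, mul_assoc,
    mul_div_mul_left _ _ (pow_ne_zero 3 (inv_ne_zero h)), mul_div_assoc]

/-- Translation by the 2-torsion point `(0, 0)` sends `x` to `lam / x` and does not change the
double; scaling by `lam⁻¹` then gives `x⁻¹`. -/
theorem double_inv_inv {lam : F} (h : lam ≠ 0) (x : F) :
    double lam⁻¹ x⁻¹ = lam⁻¹ * double lam x := by
  rcases eq_or_ne x 0 with rfl | hx
  · simp [double]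
  have h1 : ((x⁻¹) ^ 2 - lam⁻¹) ^ 2 = (lam ^ 2 * x ^ 4)⁻¹ * (x ^ 2 - lam) ^ 2 := by
    field_simp
    ring
  have h2 : 4 * x⁻¹ * (x⁻¹ - 1) * (x⁻¹ - lam⁻¹) =
      (lam * x ^ 4)⁻¹ * (4 * x * (x - 1) * (x - lam)) := by
    field_simp
    ring
  rw [double, double, h1, h2, mul_div_mul_comm]
  congr 1
  field_simp

theorem FiniteOrbit.inv_inv {lam x : F} (hlam : lam ≠ 0) (h : FiniteOrbit lam x) :
    FiniteOrbit lam⁻¹ x⁻¹ := by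
  have hs : Function.Semiconj (lam⁻¹ * ·) (LegendreTorsion.double lam)
      (LegendreTorsion.double lam⁻¹) := fun x => (double_inv_mul hlam x).symm
  have key (n : ℕ) : (LegendreTorsion.double lam⁻¹)^[n + 1] x⁻¹ =
      lam⁻¹ * (LegendreTorsion.double lam)^[n + 1] x := by
    rw [Function.iterate_succ_apply, double_inv_inv hlam, Function.iterate_succ_apply]
    exact ((hs.iterate_right n).eq _).symm
  -- The two orbits are proportional only from the first double on.
  obtain ⟨m, n, hmn, h⟩ := h.succ
  exact ⟨m + 1, n + 1, by omega, by rw [key, key, h]⟩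

end Doubling

/-! ### Torsion points have finite orbits -/

/-- The `x`-coordinate of a point, with value `0` at infinity. -/
def xCoord {lam : ℂ} : (legendre lam).Point → ℂ
  | .zero => 0
  | .some x _ _ => x

open Classical in
theorem xCoord_add_self {lam : ℂ} (P : (legendre lam).Point) :
    xCoord (P + P) = double lam (xCoord P) := by
  rcases P with _ | ⟨x, y, h⟩
  · change xCoord (0 + 0 : (legendre lam).Point) = double lam 0
    rw [add_zero]
    change (0 : ℂ) = _
    simp [double]
  have he : y ^ 2 = x * (x - 1) * (x - lam) := (legendre_equation lam x y).1 h.1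
  by_cases hy : y = (legendre lam).negY x y
  · rw [WeierstrassCurve.Affine.Point.add_self_of_Y_eq hy]
    change (0 : ℂ) = double lam x
    have hy0 : y = 0 := by
      simp only [WeierstrassCurve.Affine.negY, legendre] at hy
      linear_combination hy / 2
    have h0 : 4 * x * (x - 1) * (x - lam) = 0 := by
      linear_combination -4 * he + 4 * y * hy0
    rw [double, h0, div_zero]
  · rw [WeierstrassCurve.Affine.Point.add_self_of_Y_ne hy]
    change (legendre lam).addX x x ((legendre lam).slope x x y y) = double lam x
    rw [WeierstrassCurve.Affine.slope_of_Y_ne rfl hy]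
    have hy0 : y ≠ 0 := by
      rintro rfl
      simp [WeierstrassCurve.Affine.negY, legendre] at hy
    have h4 : 4 * x * (x - 1) * (x - lam) = 4 * y ^ 2 := by linear_combination -4 * he
    rw [double, h4]
    simp only [WeierstrassCurve.Affine.addX, WeierstrassCurve.Affine.negY, legendre]
    have hyy : y - (-y - 0 * x - 0) = 2 * y := by ring
    rw [hyy]
    field_simp
    linear_combination (16 * (1 + lam) - 32 * x) * he

theorem finiteOrbit_of_mem_T {α lam : ℂ} (h : lam ∈ T α) : FiniteOrbit lam α := by
  classical
  obtain ⟨-, -, y, hns, ht⟩ := h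
  set P : (legendre lam).Point := .some α y hns
  have horb (n : ℕ) : xCoord (2 ^ n • P) = (double lam)^[n] α := by
    induction n with
    | zero => rw [pow_zero, one_nsmul]; rfl
    | succ n ih =>
      rw [pow_succ, mul_two, add_nsmul, Function.iterate_succ_apply', ← ih]
      convert xCoord_add_self (2 ^ n • P)
  have hfin : Finite (AddSubmonoid.multiples P) := by
    refine Set.Finite.to_subtype (finite_multiples.2 ?_)
    convert ht
  obtain ⟨m, n, hmn, he⟩ := Finite.exists_ne_map_eq_of_infinite
    (fun n : ℕ => (⟨2 ^ n • P, 2 ^ n, rfl⟩ : AddSubmonoid.multiples P))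
  have he' : (double lam)^[m] α = (double lam)^[n] α := by
    rw [← horb, ← horb]
    exact congrArg xCoord (Subtype.ext_iff.1 he)
  rcases lt_or_gt_of_ne hmn with hlt | hlt
  · exact ⟨m, n, hlt, he'⟩
  · exact ⟨n, m, hlt, he'.symm⟩

/-! ### The parameter of a finite orbit is algebraic -/

section Algebraic

open Polynomial

variable {K : Type*} [Field K]

/-- Numerator and denominator of the iterates of the doubling map at `a`, as polynomials in the
parameter `lam`. -/
def orbitPoly (a : K) : ℕ → K[X] × K[X]
  | 0 => (C a, 1)
  | n + 1 =>
    let A := (orbitPoly a n).1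
    let B := (orbitPoly a n).2
    ((A ^ 2 - X * B ^ 2) ^ 2, 4 * A * B * (A - B) * (A - X * B))

/-- All iterates have a simple pole at `lam = a`; the residue is divided by `4` in each step. -/
theorem orbitPoly_pole {a : K} (h0 : a ≠ 0) (h1 : a ≠ 1) (n : ℕ) :
    (orbitPoly a (n + 1)).1.eval a ≠ 0 ∧ (orbitPoly a (n + 1)).2.eval a = 0 ∧
      (orbitPoly a (n + 1)).2.derivative.eval a * (a * (a - 1)) =
        -4 ^ (n + 1) * (orbitPoly a (n + 1)).1.eval a := by
  induction n with
  | zero =>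
    refine ⟨?_, ?_, ?_⟩
    · simp only [orbitPoly, eval_pow, eval_sub, eval_mul, eval_X, eval_C, eval_one]
      refine pow_ne_zero 2 ?_
      rw [show a ^ 2 - a * 1 ^ 2 = a * (a - 1) by ring]
      exact mul_ne_zero h0 (sub_ne_zero.2 h1)
    · simp [orbitPoly]
    · simp [orbitPoly, derivative_mul]
      ring
  | succ n ih =>
    obtain ⟨hA, hB, hd⟩ := ih
    rw [orbitPoly]
    set A := (orbitPoly a (n + 1)).1
    set B := (orbitPoly a (n + 1)).2
    refine ⟨?_, ?_, ?_⟩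
    · simp [hB, hA]
    · simp [hB]
    -- As `B` vanishes at `a`, the new denominator has derivative `4 A³ B'` there and the new
    -- numerator is `A⁴`.
    · simp [derivative_mul, hB]
      linear_combination 4 * (eval a A) ^ 3 * hd

theorem isAlgebraic_of_finiteOrbit [CharZero K] {L : Type*} [Field L] [Algebra K L] {a : K}
    (h0 : a ≠ 0) (h1 : a ≠ 1) {lam : L} (h : FiniteOrbit lam (algebraMap K L a)) :
    IsAlgebraic K lam := by
  by_contra htr
  have hne {p : K[X]} (hp : p ≠ 0) : aeval lam p ≠ 0 := fun h => htr ⟨p, hp, h⟩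
  have hz : a * (a - 1) ≠ 0 := mul_ne_zero h0 (sub_ne_zero.2 h1)
  have hB (n : ℕ) : (orbitPoly a n).2 ≠ 0 := by
    cases n with
    | zero => simp [orbitPoly]
    | succ n =>
      intro hB
      obtain ⟨hA, -, hd⟩ := orbitPoly_pole h0 h1 n
      rw [hB] at hd
      simp [hA] at hd
  have horb (n : ℕ) : (double lam)^[n] (algebraMap K L a) =
      aeval lam (orbitPoly a n).1 / aeval lam (orbitPoly a n).2 := by
    induction n with
    | zero => simp [orbitPoly]
    | succ n ih =>
      rw [Function.iterate_succ_apply', ih, orbitPoly]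
      have hb := hne (hB n)
      simp only [map_pow, map_sub, map_mul, aeval_X, map_ofNat]
      set A := aeval lam (orbitPoly a n).1
      set B := aeval lam (orbitPoly a n).2
      rw [double]
      have e1 : ((A / B) ^ 2 - lam) ^ 2 = (A ^ 2 - lam * B ^ 2) ^ 2 / B ^ 4 := by
        field_simp
      have e2 : 4 * (A / B) * (A / B - 1) * (A / B - lam) =
          4 * A * B * (A - B) * (A - lam * B) / B ^ 4 := by
        field_simp
      rw [e1, e2, div_div_div_cancel_right₀ (pow_ne_zero 4 hb)]
  -- The pole exists only from the first iterate on. For transcendental `lam`, equal iterates give a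
  -- polynomial identity; its derivative at `a` equates the residues.
  obtain ⟨m, n, hmn, h⟩ := h.succ
  rw [horb, horb, div_eq_div_iff (hne (hB _)) (hne (hB _)), ← map_mul, ← map_mul, ← sub_eq_zero,
    ← map_sub] at h
  have hp : (orbitPoly a (m + 1)).1 * (orbitPoly a (n + 1)).2 -
      (orbitPoly a (n + 1)).1 * (orbitPoly a (m + 1)).2 = 0 := by
    by_contra hp
    exact hne hp h
  obtain ⟨hAm, hBm, hdm⟩ := orbitPoly_pole h0 h1 m
  obtain ⟨hAn, hBn, hdn⟩ := orbitPoly_pole h0 h1 n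
  have hder := congrArg (fun p => p.derivative.eval a) hp
  simp only [derivative_sub, derivative_mul, eval_sub, eval_add, eval_mul, hBm, hBn,
    derivative_zero, eval_zero] at hder
  have h4 : (4 : K) ^ (m + 1) = 4 ^ (n + 1) := by
    refine mul_right_cancel₀ (mul_ne_zero hAm hAn) ?_
    linear_combination a * (a - 1) * hder + (orbitPoly a (n + 1)).1.eval a * hdm -
      (orbitPoly a (m + 1)).1.eval a * hdn
  have h4' : 4 ^ (m + 1) = 4 ^ (n + 1) := by exact_mod_cast h4
  have := Nat.pow_right_injective (le_refl 2 |>.trans (by norm_num : 2 ≤ 4)) h4'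
  omega

end Algebraic

theorem mem_QBar_of_mem_T {α : QBar} (h0 : α ≠ 0) (h1 : α ≠ 1) {lam : ℂ} (h : lam ∈ T (α : ℂ)) :
    lam ∈ QBar := by
  have halg : IsAlgebraic QBar lam :=
    isAlgebraic_of_finiteOrbit h0 h1 (finiteOrbit_of_mem_T h)
  have : Algebra.IsAlgebraic ℚ QBar := algebraicClosure.isAlgebraic ℚ ℂ
  exact mem_algebraicClosure_iff.2 (halg.restrictScalars ℚ)

/-! ### Reduction at a place above `2` -/

section Valuation

variable {F Γ : Type*} [Field F] [LinearOrderedCommGroupWithZero Γ] {v : Valuation F Γ}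

theorem not_finiteOrbit_of_escape {lam x : F}
    (h : ∀ n, v ((double lam)^[n + 1] x) < v ((double lam)^[n + 2] x)) :
    ¬ FiniteOrbit lam x := by
  intro hf
  obtain ⟨m, n, hmn, he⟩ := hf.succ
  have hmono : StrictMono fun n => v ((double lam)^[n + 1] x) := strictMono_nat_of_lt_succ h
  exact (hmono hmn).ne (congrArg v he)

theorem valuation_four_lt_one (h2 : v 2 < 1) : v 4 < 1 := by
  rw [show (4 : F) = 2 * 2 by norm_num, map_mul]
  exact mul_lt_one_of_nonneg_of_lt_one_left zero_le h2 h2.le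

/-- The numerator has value `v x ^ 4` and the denominator `v 4 * v x ^ 3`, so doubling divides `v x`
by `v 4 < 1`. -/
theorem valuation_lt_double [CharZero F] (h2 : v 2 < 1) {lam x : F} (hlam : v lam ≤ 1)
    (hx : 1 < v x) : v x < v (double lam x) := by
  have h1 : v (x - 1) = v x := Valuation.map_sub_eq_of_lt_left v (by rwa [map_one])
  have hl : v (x - lam) = v x := Valuation.map_sub_eq_of_lt_left v (hlam.trans_lt hx)
  have hxx : 1 < v (x ^ 2) := by
    rw [map_pow]
    exact one_lt_pow₀ hx two_ne_zero
  have hs : v (x ^ 2 - lam) = v x ^ 2 := by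
    rw [Valuation.map_sub_eq_of_lt_left v (hlam.trans_lt hxx), map_pow]
  have hx0 : 0 < v x := zero_lt_one.trans hx
  have h4 : 0 < v 4 := zero_lt_iff.2 ((Valuation.ne_zero_iff v).2 (by norm_num))
  rw [double, map_div₀, map_mul, map_mul, map_mul, map_pow, h1, hl, hs,
    lt_div_iff₀ (mul_pos (mul_pos (mul_pos h4 hx0) hx0) hx0)]
  calc v x * (v 4 * v x * v x * v x) = v 4 * (v x ^ 2) ^ 2 := by simp only [pow_two]; ac_rfl
    _ < 1 * (v x ^ 2) ^ 2 := by
      exact mul_lt_mul_of_pos_right (valuation_four_lt_one h2) (pow_pos (pow_pos hx0 2) 2)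
    _ = _ := one_mul _

theorem not_finiteOrbit_of_one_lt_double [CharZero F] (h2 : v 2 < 1) {lam x : F} (hlam : v lam ≤ 1)
    (hx : 1 < v (double lam x)) : ¬ FiniteOrbit lam x := by
  have hbig (n : ℕ) : 1 < v ((double lam)^[n + 1] x) := by
    induction n with
    | zero => exact hx
    | succ n ih =>
      rw [Function.iterate_succ_apply']
      exact ih.trans (valuation_lt_double h2 hlam ih)
  refine not_finiteOrbit_of_escape (v := v) fun n => ?_
  rw [Function.iterate_succ_apply' _ (n + 1)]
  exact valuation_lt_double h2 hlam (hbig n)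

theorem FiniteOrbit.valuation_le_one [CharZero F] (h2 : v 2 < 1) {lam x : F} (hlam : v lam ≤ 1)
    (h : FiniteOrbit lam x) : v x ≤ 1 := by
  by_contra! hx
  exact not_finiteOrbit_of_one_lt_double h2 hlam (hx.trans (valuation_lt_double h2 hlam hx)) h

/-- Outside the `2`-torsion, a finite orbit of integral parameter stays in the residue class of
the square root of the parameter. -/
theorem FiniteOrbit.valuation_sq_sub_lt_one [CharZero F] (h2 : v 2 < 1) {lam x : F}
    (hlam : v lam ≤ 1) (h : FiniteOrbit lam x) (h0 : x ≠ 0) (h1 : x ≠ 1) (hl : x ≠ lam) :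
    v (x ^ 2 - lam) < 1 := by
  by_contra! hge
  have hx := h.valuation_le_one h2 hlam
  refine not_finiteOrbit_of_one_lt_double h2 hlam ?_ h
  have hden : 4 * x * (x - 1) * (x - lam) ≠ 0 :=
    mul_ne_zero (mul_ne_zero (mul_ne_zero (by norm_num) h0) (sub_ne_zero.2 h1)) (sub_ne_zero.2 hl)
  have hx1 : v (x - 1) ≤ 1 := v.map_sub_le hx (by rw [map_one])
  have hxl : v (x - lam) ≤ 1 := v.map_sub_le hx hlam
  rw [LegendreTorsion.double, map_div₀,
    one_lt_div₀ (zero_lt_iff.2 ((Valuation.ne_zero_iff v).2 hden))]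
  calc v (4 * x * (x - 1) * (x - lam)) = v 4 * (v x * v (x - 1) * v (x - lam)) := by
        simp only [map_mul]; ac_rfl
    _ < 1 := mul_lt_one_of_nonneg_of_lt_one_left zero_le (valuation_four_lt_one h2)
        (mul_le_one' (mul_le_one' hx hx1) hxl)
    _ ≤ v ((x ^ 2 - lam) ^ 2) := by rw [map_pow]; exact one_le_pow₀ hge

/-- Outside the `2`-torsion, a finite orbit can only start at an integral value if the parameter
is integral. -/
theorem FiniteOrbit.valuation_param_le_one [CharZero F] (h2 : v 2 < 1) {lam x : F}
    (hx : v x ≤ 1) (h : FiniteOrbit lam x) (h0 : x ≠ 0) (h1 : x ≠ 1) (hl : x ≠ lam) :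
    v lam ≤ 1 := by
  by_contra! hlam
  have hlam0 : lam ≠ 0 := by
    rintro rfl
    simp at hlam
  have hinv : v lam⁻¹ < 1 := by
    rw [map_inv₀]
    exact inv_lt_one_of_one_lt₀ hlam
  -- The inverted orbit has parameter `≡ 0`, hence `x⁻¹ ≡ 0`, against the integrality of `x`.
  have hlt := (h.inv_inv hlam0).valuation_sq_sub_lt_one h2 hinv.le (inv_ne_zero h0)
    (by simpa using h1) (by simpa using hl)
  have hsq : v ((x⁻¹) ^ 2) < 1 := by
    rw [show (x⁻¹) ^ 2 = ((x⁻¹) ^ 2 - lam⁻¹) + lam⁻¹ by ring]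
    exact v.map_add_lt hlt hinv
  rw [map_pow, map_inv₀] at hsq
  exact hsq.not_ge (one_le_pow₀ ((one_le_inv₀ (zero_lt_iff.2 ((Valuation.ne_zero_iff v).2 h0))).2 hx))

theorem valuation_mul_lt_one {a b : F} (ha : v a < 1) (hb : v b ≤ 1) : v (a * b) < 1 := by
  rw [map_mul]
  exact mul_lt_one_of_nonneg_of_lt_one_left zero_le ha hb

theorem valuation_lt_one_of_sq {a : F} (h : v (a ^ 2) < 1) : v a < 1 := by
  by_contra! hge
  rw [map_pow] at h
  exact h.not_ge (one_le_pow₀ hge)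

/-- If neither `x` nor its double is `2`-torsion, then they have the same reduction. -/
theorem FiniteOrbit.valuation_double_sub_lt_one [CharZero F] (h2 : v 2 < 1) {lam x : F}
    (hx : v x ≤ 1) (h : FiniteOrbit lam x) (h0 : x ≠ 0) (h1 : x ≠ 1) (hl : x ≠ lam)
    (h0' : LegendreTorsion.double lam x ≠ 0) (h1' : LegendreTorsion.double lam x ≠ 1)
    (hl' : LegendreTorsion.double lam x ≠ lam) :
    v (LegendreTorsion.double lam x - x) < 1 := by
  have hlam := h.valuation_param_le_one h2 hx h0 h1 hl
  have hs := h.valuation_sq_sub_lt_one h2 hlam h0 h1 hl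
  have hs' := h.double.valuation_sq_sub_lt_one h2 hlam h0' h1' hl'
  have hw := h.double.valuation_le_one h2 hlam
  set w := LegendreTorsion.double lam x
  apply valuation_lt_one_of_sq
  -- Both squares reduce to `lam`, and squaring is additive modulo 2.
  rw [show (w - x) ^ 2 = (w ^ 2 - lam) - (x ^ 2 - lam) - 2 * (x * (w - x)) by ring]
  refine v.map_sub_lt (v.map_sub_lt hs' hs) (valuation_mul_lt_one h2 ?_)
  rw [map_mul]
  exact mul_le_one' hx (v.map_sub_le hw hx)

/-- Both `x² - lam = 2u x(x - 1)` and `x - lam = (2u - 1) x(x - 1)` are multiples of `x(x - 1)`,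
which cancels together with the 4. -/
theorem double_parametrization [CharZero F] {x u : F} (h0 : x ≠ 0) (h1 : x ≠ 1)
    (hl : x ≠ x ^ 2 + 2 * u * x * (1 - x)) :
    double (x ^ 2 + 2 * u * x * (1 - x)) x * (2 * u - 1) = u ^ 2 := by
  have h1' : x - 1 ≠ 0 := sub_ne_zero.2 h1
  have hu : 2 * u - 1 ≠ 0 := by
    intro hu
    exact hl (by linear_combination -x * (1 - x) * hu)
  have hden : 4 * x * (x - 1) * (x - (x ^ 2 + 2 * u * x * (1 - x))) =
      4 * x ^ 2 * (x - 1) ^ 2 * (2 * u - 1) := by ring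
  have hnum : (x ^ 2 - (x ^ 2 + 2 * u * x * (1 - x))) ^ 2 =
      4 * x ^ 2 * (x - 1) ^ 2 * u ^ 2 := by ring
  rw [double, hden, hnum, mul_comm, mul_div_assoc', mul_comm (2 * u - 1), mul_div_mul_right _ _ hu,
    mul_div_cancel_left₀]
  exact mul_ne_zero (mul_ne_zero (by norm_num) (pow_ne_zero 2 h0)) (pow_ne_zero 2 h1')

/-- A finite orbit starting at an integral value is `2`-torsion, `4`-torsion, or has parameter
`x² + 2 u x (1 - x)` with `u` integral and `u²` congruent to `x`. -/
theorem FiniteOrbit.param_cases [CharZero F] (h2 : v 2 < 1) {lam x : F}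
    (hx : v x ≤ 1) (h : FiniteOrbit lam x) (h0 : x ≠ 0) (h1 : x ≠ 1) :
    (lam = x ∨ lam = x ^ 2 ∨ lam = x * (2 - x) ∨ lam * (2 * x - 1) = x ^ 2) ∨
      ∃ u, v u ≤ 1 ∧ v (u ^ 2 - x) < 1 ∧ lam = x ^ 2 + 2 * u * x * (1 - x) := by
  rw [or_iff_not_imp_left]
  intro hS
  push Not at hS
  obtain ⟨hl, hS0, hS1, hSl⟩ := hS
  have hden : 4 * x * (x - 1) * (x - lam) ≠ 0 :=
    mul_ne_zero (mul_ne_zero (mul_ne_zero (by norm_num) h0) (sub_ne_zero.2 h1))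
      (sub_ne_zero.2 hl.symm)
  -- `0`, `1`, `lam` are branch values of the doubling map, so each equation for `lam` is a perfect
  -- square and yields a single value.
  have h0' : LegendreTorsion.double lam x ≠ 0 :=
    div_ne_zero (pow_ne_zero 2 (sub_ne_zero.2 hS0.symm)) hden
  have h1' : LegendreTorsion.double lam x ≠ 1 := by
    rw [LegendreTorsion.double, Ne, div_eq_one_iff_eq hden]
    intro he
    have : (lam - x * (2 - x)) ^ 2 = 0 := by linear_combination he
    exact hS1 (sub_eq_zero.1 (pow_eq_zero_iff two_ne_zero |>.1 this))
  have hl' : LegendreTorsion.double lam x ≠ lam := by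
    rw [LegendreTorsion.double, Ne, div_eq_iff hden]
    intro he
    have : (lam * (2 * x - 1) - x ^ 2) ^ 2 = 0 := by linear_combination he
    exact hSl (sub_eq_zero.1 (pow_eq_zero_iff two_ne_zero |>.1 this))
  have hw := h.double.valuation_le_one h2 (h.valuation_param_le_one h2 hx h0 h1 hl.symm)
  have hwx := h.valuation_double_sub_lt_one h2 hx h0 h1 hl.symm h0' h1' hl'
  have h1x : 1 - x ≠ 0 := sub_ne_zero.2 h1.symm
  obtain ⟨u, hu⟩ : ∃ u, lam = x ^ 2 + 2 * u * x * (1 - x) :=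
    ⟨(lam - x ^ 2) / (2 * x * (1 - x)), by field_simp; ring⟩
  have huw : LegendreTorsion.double lam x * (2 * u - 1) = u ^ 2 := by
    rw [hu]
    exact double_parametrization h0 h1 (hu ▸ hl.symm)
  set w := LegendreTorsion.double lam x
  -- Otherwise `u² = w(2u - 1)` would have value at most `v u < v u ^ 2`.
  have hu1 : v u ≤ 1 := by
    by_contra! hgt
    have hle : v (2 * u - 1) ≤ v u := by
      refine v.map_sub_le ?_ (by rw [map_one]; exact hgt.le)
      rw [map_mul]
      exact mul_le_of_le_one_left' h2.le
    have : v u ^ 2 ≤ v u := by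
      rw [← map_pow, ← huw, map_mul]
      exact (mul_le_of_le_one_left' hw).trans hle
    rw [sq] at this
    exact this.not_gt (lt_mul_of_one_lt_left (zero_lt_one.trans hgt) hgt)
  refine ⟨u, hu1, ?_, hu⟩
  rw [show u ^ 2 - x = 2 * (w * u - x) - (w - x) by linear_combination -huw]
  refine v.map_sub_lt (valuation_mul_lt_one h2 (v.map_sub_le ?_ hx)) hwx
  rw [map_mul]
  exact mul_le_one' hw hu1

end Valuation

/-! ### The place of `ℚ̄` induced by the embedding -/

variable (i : QBar →+* PadicAlgCl 2)

/-- The valuation of `ℚ̄` induced by the embedding into `ℚ̄₂`. -/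
def place : Valuation QBar NNReal := (PadicAlgCl.valued 2).v.comap i

theorem mem_Z_iff {x : QBar} : x ∈ Z i ↔ place i x ≤ 1 := Iff.rfl

theorem place_two : place i 2 < 1 := by
  change (PadicAlgCl.valued 2).v (i 2) < 1
  have h := PadicAlgCl.valuation_p 2
  rw [map_ofNat]
  push_cast at h
  rw [h]
  norm_num

theorem residue_eq_zero_iff_valuation (x : O2) :
    IsLocalRing.residue O2 x = 0 ↔ (PadicAlgCl.valued 2).v (x : PadicAlgCl 2) < 1 := by
  rw [IsLocalRing.residue_eq_zero_iff, ValuationSubring.valuation_lt_one_iff]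
  exact ((Valuation.isEquiv_valuation_valuationSubring _).lt_one_iff_lt_one).symm

theorem rho_eq_infty_iff {x : QBar} : rho i x = OnePoint.infty ↔ x ∉ Z i := by
  change _ ↔ ¬ i x ∈ O2
  unfold rho
  split_ifs with h <;> simp [h]

theorem rho_of_mem {x : QBar} (hx : x ∈ Z i) :
    rho i x = ((IsLocalRing.residue O2 ⟨i x, hx⟩ : F2Bar) : OnePoint F2Bar) :=
  dif_pos hx

theorem rho_eq_rho_iff {x y : QBar} (hx : x ∈ Z i) (hy : y ∈ Z i) :
    rho i x = rho i y ↔ place i (x - y) < 1 := by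
  rw [rho_of_mem i hx, rho_of_mem i hy, OnePoint.coe_eq_coe, ← sub_eq_zero, ← map_sub,
    residue_eq_zero_iff_valuation]
  change (PadicAlgCl.valued 2).v (i x - i y) < 1 ↔ (PadicAlgCl.valued 2).v (i (x - y)) < 1
  rw [map_sub i]

theorem rho_eq_zero_iff {x : QBar} (hx : x ∈ Z i) :
    rho i x = ((0 : F2Bar) : OnePoint F2Bar) ↔ place i x < 1 := by
  rw [rho_of_mem i hx, OnePoint.coe_eq_coe, residue_eq_zero_iff_valuation]
  rfl

theorem mem_S_iff {α lam : QBar} :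
    lam ∈ S α ↔ lam = α ∨ lam = α ^ 2 ∨ lam = α * (2 - α) ∨
      (2 * α - 1 ≠ 0 ∧ lam = α ^ 2 / (2 * α - 1)) := by
  simp [S, or_assoc]

theorem exists_finiteOrbit_of_mem_T {α : QBar} (h0 : α ≠ 0) (h1 : α ≠ 1) {lam : ℂ}
    (h : lam ∈ T (α : ℂ)) : ∃ l : QBar, (l : ℂ) = lam ∧ l ≠ 0 ∧ FiniteOrbit l α := by
  refine ⟨⟨lam, mem_QBar_of_mem_T h0 h1 h⟩, rfl, fun hl => h.1 (congrArg Subtype.val hl), ?_⟩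
  exact (finiteOrbit_map_iff (algebraMap QBar ℂ) _ _).1 (finiteOrbit_of_mem_T h)

theorem mem_of_finiteOrbit_of_mem_Z {α lam : QBar} (hα : α ∈ Z i) (h0 : α ≠ 0) (h1 : α ≠ 1)
    (h : FiniteOrbit lam α) : lam ∈ S α ∪ RInt i α := by
  rcases h.param_cases (place_two i) hα h0 h1 with h | ⟨u, hu, hux, hl⟩
  · left
    rw [mem_S_iff]
    rcases h with h | h | h | h
    · exact Or.inl h
    · exact Or.inr (Or.inl h)
    · exact Or.inr (Or.inr (Or.inl h))
    · have hd : 2 * α - 1 ≠ 0 := by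
        intro hd
        rw [hd, mul_zero] at h
        exact h0 (pow_eq_zero_iff two_ne_zero |>.1 h.symm)
      exact Or.inr (Or.inr (Or.inr ⟨hd, eq_div_of_mul_eq hd h⟩))
  · exact Or.inr ⟨u, hu, (rho_eq_rho_iff i (pow_mem hu 2) hα).2 hux, hl⟩

theorem S_union_RInt_subset {α : QBar} (hα : α ∈ Z i) :
    S α ∪ RInt i α ⊆ {α} ∪ {x | ∃ z ∈ Z i, x = α ^ 2 + 2 * z} := by
  have h1 : 1 - α ∈ Z i := sub_mem (one_mem _) hα
  rintro x (hx | ⟨u, hu, -, rfl⟩)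
  · rw [mem_S_iff] at hx
    rcases hx with rfl | rfl | rfl | ⟨hd, rfl⟩
    · exact Or.inl rfl
    · exact Or.inr ⟨0, zero_mem _, by ring⟩
    · exact Or.inr ⟨α * (1 - α), mul_mem hα h1, by ring⟩
    · have hinv : (2 * α - 1)⁻¹ ∈ Z i := by
        rw [mem_Z_iff, map_inv₀, ← neg_sub, Valuation.map_neg,
          Valuation.map_one_sub_of_lt _ (valuation_mul_lt_one (place_two i) hα), inv_one]
      refine Or.inr ⟨α ^ 2 * (1 - α) * (2 * α - 1)⁻¹, mul_mem (mul_mem (pow_mem hα 2) h1) hinv, ?_⟩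
      rw [div_eq_iff hd]
      linear_combination -2 * α ^ 2 * (1 - α) * inv_mul_cancel₀ hd
  · exact Or.inr ⟨u * α * (1 - α), mul_mem (mul_mem hu hα) h1, by ring⟩

theorem mem_of_finiteOrbit_of_notMem_Z {α lam : QBar} (hα : α ∉ Z i) (hlam : lam ≠ 0)
    (h : FiniteOrbit lam α) : lam ∈ S α ∪ RInf i α := by
  have hgt : 1 < place i α := not_le.1 hα
  have h0 : α ≠ 0 := fun h => hα (h ▸ zero_mem _)
  have h1 : α ≠ 1 := fun h => hα (h ▸ one_mem _)
  have hinv : place i α⁻¹ < 1 := by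
    rw [map_inv₀]
    exact inv_lt_one_of_one_lt₀ hgt
  rcases (h.inv_inv hlam).param_cases (place_two i) hinv.le (inv_ne_zero h0) (by simpa using h1)
    with h | ⟨u, hu, hux, hl⟩
  · left
    rw [mem_S_iff]
    rcases h with h | h | h | h
    · exact Or.inl (inv_injective h)
    · right; left
      rw [inv_pow] at h
      exact inv_injective h
    -- Inversion swaps the last two elements of `S`.
    · have he : α ^ 2 = lam * (2 * α - 1) := by
        field_simp at h
        linear_combination h
      have hd : 2 * α - 1 ≠ 0 := by
        intro hd
        rw [hd, mul_zero] at he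
        exact h0 (pow_eq_zero_iff two_ne_zero |>.1 he)
      exact Or.inr (Or.inr (Or.inr ⟨hd, eq_div_of_mul_eq hd he.symm⟩))
    · right; right; left
      field_simp at h
      linear_combination -h
  · right
    have he : α ^ 2 = lam * (1 + 2 * (α - 1) * u) := by
      field_simp at hl
      linear_combination hl
    have hd : 1 + 2 * (α - 1) * u ≠ 0 := by
      intro hd
      rw [hd, mul_zero] at he
      exact h0 (pow_eq_zero_iff two_ne_zero |>.1 he)
    refine ⟨u, hu, (rho_eq_zero_iff i hu).2 (valuation_lt_one_of_sq ?_), hd,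
      eq_div_of_mul_eq hd he.symm⟩
    -- The condition `u² ≡ α⁻¹` becomes `u ≡ 0`, since `α⁻¹` reduces to 0.
    rw [show u ^ 2 = (u ^ 2 - α⁻¹) + α⁻¹ by ring]
    exact (place i).map_add_lt hux hinv

end LegendreTorsion

end

theorem theoremT (i : LegendreTorsion.QBar →+* PadicAlgCl 2) :
    (∀ α : LegendreTorsion.QBar, α ∈ LegendreTorsion.Z i → α ≠ 0 → α ≠ 1 →
      LegendreTorsion.T (α : ℂ) ⊆
        (fun x : LegendreTorsion.QBar => (x : ℂ)) ''
          (LegendreTorsion.S α ∪ LegendreTorsion.RInt i α) ∧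
      LegendreTorsion.S α ∪ LegendreTorsion.RInt i α ⊆
        {α} ∪ {x | ∃ z ∈ LegendreTorsion.Z i, x = α ^ 2 + 2 * z}) ∧
    (∀ α : LegendreTorsion.QBar, LegendreTorsion.rho i α = OnePoint.infty →
      LegendreTorsion.T (α : ℂ) ⊆
        (fun x : LegendreTorsion.QBar => (x : ℂ)) ''
          (LegendreTorsion.S α ∪ LegendreTorsion.RInf i α)) := by
  refine ⟨fun α hα h0 h1 => ⟨fun lam hlam => ?_, LegendreTorsion.S_union_RInt_subset i hα⟩,
    fun α hα lam hlam => ?_⟩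
  · obtain ⟨l, rfl, -, hl⟩ := LegendreTorsion.exists_finiteOrbit_of_mem_T h0 h1 hlam
    exact ⟨l, LegendreTorsion.mem_of_finiteOrbit_of_mem_Z i hα h0 h1 hl, rfl⟩
  · rw [LegendreTorsion.rho_eq_infty_iff] at hα
    obtain ⟨l, rfl, hl0, hl⟩ := LegendreTorsion.exists_finiteOrbit_of_mem_T
      (by rintro rfl; exact hα (zero_mem _)) (by rintro rfl; exact hα (one_mem _)) hlam
    exact ⟨l, LegendreTorsion.mem_of_finiteOrbit_of_notMem_Z i hα hl0 hl, rfl⟩
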